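/- Fix an integer $p\ge 1$ and reals $0<\mu\le L$, $D>0$. For each $n$ let $\mathcal F_n$ be the class of problems $\min_{x\in X} f(x)$, where $X\subset\mathbb R^n$ is a nonempty compact convex set of Euclidean diameter at most $D$ and $f:\mathbb R^n\to\mathbb R$ is $\mu$-strongly convex on $X$ and differentiable at the points of $X$, with $\|\nabla f(x)-\nabla f(y)\|_2\le L\|x-y\|_2$ for all $x,y\in X$. A linear minimization oracle for $X$ is a map $\mathrm{LMO}:\mathbb R^n\to X$ with $\mathrm{LMO}(q)\in\operatorname{Argmin}_{x\in X}\langle q,x\rangle$ for every $q\in\mathbb R^n$. A conditional-gradient-type method in $\mathbb R^n$ is given a starting point $x_0\in X$, and at iteration $k=1,2,\dots$ it chooses a vector $p_k\in\mathbb R^n$ by an arbitrary rule, receives $x_k=\mathrm{LMO}(p_k)$, and returns a point $y_k\in\operatorname{Conv}\{x_0,\dots,x_k\}$, chosen by an arbitrary rule; before the first iteration $y_0=x_0$; the rules may use $X$, $f$, the target accuracy $\varepsilon$ and the points obtained so far. Its iteration complexity on $\mathcal F_n$ is at most $T(\varepsilon)$ if for every problem in $\mathcal F_n$, every linear minimization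 oracle for $X$, every starting point $x_0\in X$ and every $\varepsilon>0$ there is an integer $0\le k\le T(\varepsilon)$ with $f(y_k)-\min_X f\le\varepsilon$. **Theorem.** Suppose that for every $n$ a conditional-gradient-type method $\mathcal M_n$ in $\mathbb R^n$ has iteration complexity at most $C_n\max\left(\ln^p\frac1\varepsilon,\,1\right)$ on $\mathcal F_n$, where $C_n$ does not depend on $\varepsilon$, on the problem, on the oracle or on the starting point. Then $C_n=\widetilde\Omega(\sqrt n)$; precisely, there are $c>0$ and $n_0$, depending only on $p,\mu,L,D$ (not on the methods and not on the sequence $(C_n)$), such that $$C_n\ \ge\ c\,\frac{\sqrt n}{\ln^p n}\qquad\text{for all } n\ge n_0.$$ -/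

import Mathlib

/-- `ℝⁿ` with the Euclidean norm and inner product. -/
abbrev EucSpace (n : ℕ) : Type := EuclideanSpace ℝ (Fin n)

/-- The strongly convex smooth problem class with parameters `μ`, `L`, `D`:
minimize `f` over a nonempty compact convex set `X ⊆ ℝⁿ` of diameter at most `D`, where `f` is
`μ`-strongly convex on `X` and has an `L`-Lipschitz gradient on `X`. -/
structure IsStronglyConvexSmoothProblem {n : ℕ} (μ L D : ℝ) (X : Set (EucSpace n))
    (f : EucSpace n → ℝ) : Prop where
  nonempty : X.Nonempty
  convex : Convex ℝ X
  compact : IsCompact X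
  diam_le : Metric.diam X ≤ D
  strongConvexOn : StrongConvexOn X μ f
  differentiableAt : ∀ x ∈ X, DifferentiableAt ℝ f x
  gradient_lipschitz : ∀ x ∈ X, ∀ y ∈ X, ‖gradient f x - gradient f y‖ ≤ L * ‖x - y‖

/-- `lmo` is a linear minimization oracle for `X`: `lmo p ∈ Argmin_{x ∈ X} ⟨p, x⟩` for all `p`. -/
def IsLMO {n : ℕ} (X : Set (EucSpace n)) (lmo : EucSpace n → EucSpace n) : Prop :=
  ∀ p, lmo p ∈ X ∧ ∀ z ∈ X, inner ℝ p (lmo p) ≤ inner ℝ p z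

/-- A conditional-gradient-type method in `ℝⁿ`. It is given by two arbitrary rules, which may use
the feasible set, the objective, the target accuracy and the list `[x₀, …, x_k]` of the starting
point and the oracle answers obtained so far:
* `query` chooses the next vector `p_{k+1}` passed to the oracle;
* `output` chooses the returned point `y_k`, which has to lie in `Conv {x₀, …, x_k}`. -/
structure CondGradMethod (n : ℕ) where
  query : Set (EucSpace n) → (EucSpace n → ℝ) → ℝ → List (EucSpace n) → EucSpace n
  output : Set (EucSpace n) → (EucSpace n → ℝ) → ℝ → List (EucSpace n) → EucSpace n
  output_mem : ∀ X f ε h, h ≠ [] → output X f ε h ∈ convexHull ℝ {v | v ∈ h}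

namespace CondGradMethod

variable {n : ℕ}

/-- The list `[x₀, x₁, …, x_k]` produced by the first `k` iterations, where
`x_{j+1} = lmo p_{j+1}` and `p_{j+1}` is chosen by the rule `query` from `[x₀, …, x_j]`. -/
def history (M : CondGradMethod n) (X : Set (EucSpace n)) (f : EucSpace n → ℝ)
    (lmo : EucSpace n → EucSpace n) (x₀ : EucSpace n) (ε : ℝ) : ℕ → List (EucSpace n)
  | 0 => [x₀]
  | k + 1 =>
      M.history X f lmo x₀ ε k ++ [lmo (M.query X f ε (M.history X f lmo x₀ ε k))]

/-- The point `y_k` returned after `k` iterations (that is, after `k` oracle calls). -/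
def point (M : CondGradMethod n) (X : Set (EucSpace n)) (f : EucSpace n → ℝ)
    (lmo : EucSpace n → EucSpace n) (x₀ : EucSpace n) (ε : ℝ) (k : ℕ) : EucSpace n :=
  M.output X f ε (M.history X f lmo x₀ ε k)

/-- The method `M` has iteration complexity (at most) `T ε` on the strongly convex smooth class with
parameters `μ`, `L`, `D`: for every problem of the class, every linear minimization oracle
for its feasible set, every starting point and every accuracy `ε > 0`, a point with
`f (y_k) - min_X f ≤ ε` is returned after some number `k ≤ T ε` of iterations. -/
def HasComplexity (M : CondGradMethod n) (μ L D : ℝ) (T : ℝ → ℝ) : Prop :=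
  ∀ (X : Set (EucSpace n)) (f : EucSpace n → ℝ), IsStronglyConvexSmoothProblem μ L D X f →
    ∀ lmo : EucSpace n → EucSpace n, IsLMO X lmo →
      ∀ x₀ ∈ X, ∀ ε : ℝ, 0 < ε →
        ∃ k : ℕ, (k : ℝ) ≤ T ε ∧ ∀ z ∈ X, f (M.point X f lmo x₀ ε k) - f z ≤ ε

end CondGradMethod

/-! Take `μ / 2 * ‖y‖ ^ 2` on the simplex of scale `D / 2`, with an oracle that answers only
vertices. After `k` calls the output is a convex combination of at most `k + 1` vertices, so its
squared norm is at least `s ^ 2 / (k + 1)`, while the barycentre attains `s ^ 2 / n`. Accuracy of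
order `1 / n` therefore costs about `n / 2` calls, whatever the rules (`half_sub_one_le`). At that
accuracy `log (1 / ε)` is of order `log n`, which gives even `n / log n ^ p`; the stated `√n` is
weaker. -/

/-- The vertices `s • eᵢ` of the scaled standard simplex. -/
noncomputable def simplexVertex {n : ℕ} (s : ℝ) (i : Fin n) : EucSpace n :=
  EuclideanSpace.single i s

/-- The scaled standard simplex `conv {s • e₁, …, s • eₙ}`. -/
def scaledSimplex (n : ℕ) (s : ℝ) : Set (EucSpace n) :=
  convexHull ℝ (Set.range (simplexVertex s))

theorem simplexVertex_mem {n : ℕ} (s : ℝ) (i : Fin n) : simplexVertex s i ∈ scaledSimplex n s :=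
  subset_convexHull ℝ _ ⟨i, rfl⟩

theorem diam_scaledSimplex_le {n : ℕ} {s : ℝ} (hs : 0 ≤ s) :
    Metric.diam (scaledSimplex n s) ≤ 2 * s := by
  rw [scaledSimplex, convexHull_diam]
  refine Metric.diam_le_of_forall_dist_le (by positivity) ?_
  rintro _ ⟨i, rfl⟩ _ ⟨j, rfl⟩
  calc dist (simplexVertex s i) (simplexVertex s j)
      ≤ ‖simplexVertex s i‖ + ‖simplexVertex s j‖ := dist_le_norm_add_norm _ _
    _ = 2 * s := by simp [simplexVertex, abs_of_nonneg hs, two_mul]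

theorem hasGradientAt_half_mul_norm_sq {n : ℕ} (μ : ℝ) (x : EucSpace n) :
    HasGradientAt (fun y : EucSpace n => μ / 2 * ‖y‖ ^ 2) (μ • x) x := by
  rw [hasGradientAt_iff_hasFDerivAt]
  refine ((hasStrictFDerivAt_norm_sq x).hasFDerivAt.const_mul (μ / 2)).congr_fderiv ?_
  ext y
  simp
  ring

theorem isStronglyConvexSmoothProblem_scaledSimplex {n : ℕ} (hn : 0 < n) {μ L D s : ℝ}
    (hμ : 0 ≤ μ) (hμL : μ ≤ L) (hs : 0 ≤ s) (hsD : 2 * s ≤ D) :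
    IsStronglyConvexSmoothProblem μ L D (scaledSimplex n s) (fun y => μ / 2 * ‖y‖ ^ 2) where
  nonempty := ⟨_, simplexVertex_mem s ⟨0, hn⟩⟩
  convex := convex_convexHull ℝ _
  compact := (Set.finite_range (simplexVertex s)).isCompact_convexHull (𝕜 := ℝ)
  diam_le := (diam_scaledSimplex_le hs).trans hsD
  strongConvexOn := by
    -- Subtracting the quadratic of modulus `μ` leaves the zero function.
    rw [strongConvexOn_iff_convex]
    simp only [sub_self]
    exact convexOn_const (0 : ℝ) (convex_convexHull ℝ _)
  differentiableAt x _ := (hasGradientAt_half_mul_norm_sq μ x).differentiableAt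
  gradient_lipschitz x _ y _ := by
    rw [(hasGradientAt_half_mul_norm_sq μ x).gradient,
      (hasGradientAt_half_mul_norm_sq μ y).gradient, ← smul_sub, norm_smul, Real.norm_of_nonneg hμ]
    gcongr

/-- The simplex has a linear minimization oracle all of whose answers are vertices. -/
theorem exists_isLMO_scaledSimplex {n : ℕ} (hn : 0 < n) (s : ℝ) :
    ∃ a : EucSpace n → Fin n, IsLMO (scaledSimplex n s) (fun q => simplexVertex s (a q)) := by
  have : Nonempty (Fin n) := ⟨⟨0, hn⟩⟩
  choose a ha using fun q : EucSpace n =>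
    Finite.exists_min (fun i : Fin n => inner ℝ q (simplexVertex s i))
  refine ⟨a, fun q => ⟨simplexVertex_mem s _, fun z hz => ?_⟩⟩
  have hconv : Convex ℝ {z : EucSpace n | inner ℝ q (simplexVertex s (a q)) ≤ inner ℝ q z} :=
    convex_halfSpace_ge (innerₛₗ ℝ q).isLinear _
  refine convexHull_min ?_ hconv hz
  rintro _ ⟨i, rfl⟩
  exact ha q i

/-- Only the number of vertices seen matters later; the `+ 1` counts the starting point. -/
theorem CondGradMethod.exists_history_eq_map {n : ℕ} (M : CondGradMethod n) (X : Set (EucSpace n))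
    (f : EucSpace n → ℝ) {ι : Type*} (v : ι → EucSpace n) (a : EucSpace n → ι) (i : ι) (ε : ℝ)
    (k : ℕ) :
    ∃ l : List ι, l.length = k + 1 ∧ M.history X f (fun q => v (a q)) (v i) ε k = l.map v := by
  induction k with
  | zero => exact ⟨[i], rfl, rfl⟩
  | succ k ih =>
    obtain ⟨l, hl, h⟩ := ih
    refine ⟨l ++ [a (M.query X f ε (l.map v))], by simp [hl], ?_⟩
    rw [CondGradMethod.history, h]
    simp

/-- A convex combination of few vertices of the simplex has large norm. -/
theorem sq_le_length_mul_norm_sq {n : ℕ} {s : ℝ} (l : List (Fin n)) {y : EucSpace n}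
    (hy : y ∈ convexHull ℝ {v | v ∈ l.map (simplexVertex s)}) :
    s ^ 2 ≤ l.length * ‖y‖ ^ 2 := by
  -- This affine condition holds at each listed vertex, hence on their hull; Cauchy–Schwarz then
  -- bounds the norm below.
  have hmem : ∑ i ∈ l.toFinset, y i = s := by
    have hconv : Convex ℝ {y : EucSpace n | ∑ i ∈ l.toFinset, y i = s} := by
      refine convex_hyperplane (f := fun y : EucSpace n => ∑ i ∈ l.toFinset, y i) ⟨?_, ?_⟩ s
      · intro x y
        simp [Finset.sum_add_distrib]
      · intro c x
        simp [Finset.mul_sum]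
    refine convexHull_min ?_ hconv hy
    intro v hv
    obtain ⟨i, hi, rfl⟩ := List.mem_map.1 hv
    simp [simplexVertex, hi]
  calc s ^ 2 = (∑ i ∈ l.toFinset, y i) ^ 2 := by rw [hmem]
    _ ≤ l.toFinset.card * ∑ i ∈ l.toFinset, y i ^ 2 := sq_sum_le_card_mul_sum_sq
    _ ≤ l.length * ‖y‖ ^ 2 := by
      rw [EuclideanSpace.real_norm_sq_eq]
      gcongr
      · exact List.toFinset_card_le l
      · exact Finset.subset_univ _

theorem exists_mem_scaledSimplex_norm_sq_eq {n : ℕ} (hn : 0 < n) (s : ℝ) :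
    ∃ z ∈ scaledSimplex n s, ‖z‖ ^ 2 = s ^ 2 / n := by
  have hn' : (n : ℝ) ≠ 0 := by positivity
  -- The barycentre.
  refine ⟨∑ i : Fin n, (1 / n : ℝ) • simplexVertex s i, ?_, ?_⟩
  · refine (convex_convexHull ℝ _).sum_mem (fun _ _ => by positivity) ?_
      fun i _ => simplexVertex_mem s i
    simp [hn']
  · rw [EuclideanSpace.real_norm_sq_eq]
    simp [simplexVertex, Pi.single_apply]
    field_simp

/-- On the simplex, accuracy `μ s² / (2 n)` takes at least `n / 2 - 1` iterations. -/
theorem CondGradMethod.HasComplexity.half_sub_one_le {n : ℕ} (hn : 0 < n) {μ L D s : ℝ}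
    (hμ : 0 < μ) (hμL : μ ≤ L) (hs : 0 < s) (hsD : 2 * s ≤ D) {M : CondGradMethod n} {T : ℝ → ℝ}
    (h : M.HasComplexity μ L D T) : (n : ℝ) / 2 - 1 ≤ T (μ * s ^ 2 / (2 * n)) := by
  have hn' : (0 : ℝ) < n := by exact_mod_cast hn
  obtain ⟨a, ha⟩ := exists_isLMO_scaledSimplex hn s
  obtain ⟨z, hz, hzn⟩ := exists_mem_scaledSimplex_norm_sq_eq hn s
  obtain ⟨k, hkT, hk⟩ := h _ _
    (isStronglyConvexSmoothProblem_scaledSimplex hn hμ.le hμL hs.le hsD) _ ha _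
    (simplexVertex_mem s ⟨0, hn⟩) (μ * s ^ 2 / (2 * n)) (by positivity)
  refine le_trans ?_ hkT
  specialize hk z hz
  obtain ⟨l, hl, hist⟩ := M.exists_history_eq_map (scaledSimplex n s)
    (fun y => μ / 2 * ‖y‖ ^ 2) (simplexVertex s) a ⟨0, hn⟩ (μ * s ^ 2 / (2 * n)) k
  rw [CondGradMethod.point, hist] at hk
  set y := M.output (scaledSimplex n s) (fun y => μ / 2 * ‖y‖ ^ 2) (μ * s ^ 2 / (2 * n))
    (l.map (simplexVertex s))
  have hsy : s ^ 2 ≤ l.length * ‖y‖ ^ 2 :=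
    sq_le_length_mul_norm_sq l (M.output_mem _ _ _ _ (by
      intro h0
      simp [List.map_eq_nil_iff.1 h0] at hl))
  rw [hl, Nat.cast_add, Nat.cast_one] at hsy
  have hyn : ‖y‖ ^ 2 ≤ 2 * s ^ 2 / n := by
    rw [hzn] at hk
    have : μ / 2 * ‖y‖ ^ 2 ≤ μ / 2 * (2 * s ^ 2 / n) := by
      calc μ / 2 * ‖y‖ ^ 2 ≤ μ * s ^ 2 / (2 * n) + μ / 2 * (s ^ 2 / n) := by linarith
        _ = μ / 2 * (2 * s ^ 2 / n) := by field_simp; ring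
    exact le_of_mul_le_mul_left this (by positivity)
  have hle : s ^ 2 * 1 ≤ s ^ 2 * ((k + 1) * 2 / n) := by
    calc s ^ 2 * 1 ≤ (k + 1) * ‖y‖ ^ 2 := by linarith
      _ ≤ (k + 1) * (2 * s ^ 2 / n) := by gcongr
      _ = s ^ 2 * ((k + 1) * 2 / n) := by ring
  have := le_of_mul_le_mul_left hle (by positivity)
  rw [le_div_iff₀ hn'] at this
  linarith

/-- The two bounds on `x` say that `|log a| ≤ log x`. -/
theorem abs_log_mul_le_two_mul_log {a x : ℝ} (ha : 0 < a) (hx : 0 < x) (hax : a ≤ x)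
    (hax' : 1 / a ≤ x) : |Real.log (a * x)| ≤ 2 * Real.log x := by
  have h1 := Real.log_le_log ha hax
  have h2 := Real.log_le_log (by positivity) hax'
  rw [one_div, Real.log_inv] at h2
  rw [Real.log_mul ha.ne' hx.ne', abs_le]
  constructor <;> linarith

theorem mainTheorem1 (p : ℕ) (hp : 1 ≤ p) (μ L D : ℝ) (hμ : 0 < μ) (hμL : μ ≤ L) (hD : 0 < D) :
    ∃ c : ℝ, 0 < c ∧ ∃ n₀ : ℕ, ∀ (M : (n : ℕ) → CondGradMethod n) (C : ℕ → ℝ),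
      (∀ n : ℕ, (M n).HasComplexity μ L D (fun ε => C n * max (Real.log (1 / ε) ^ p) 1)) →
        ∀ n : ℕ, n₀ ≤ n → c * (Real.sqrt n / Real.log n ^ p) ≤ C n := by
  set a : ℝ := 2 / (μ * (D / 2) ^ 2) with ha_def
  have ha : 0 < a := by positivity
  -- `n ≥ 4` gives `n / 2 - 1 ≥ n / 4` and `log n ≥ 1`; the other bound absorbs `a` into `2 * log
  -- n`, whence `2 ^ p`.
  refine ⟨1 / (4 * 2 ^ p), by positivity, max 4 ⌈max a (1 / a)⌉₊, fun M C h n hn => ?_⟩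
  obtain ⟨hn4, hna⟩ := max_le_iff.1 hn
  obtain ⟨han, han'⟩ := max_le_iff.1 (Nat.ceil_le.1 hna)
  have hn4' : (4 : ℝ) ≤ n := by exact_mod_cast hn4
  have hlog : 1 ≤ Real.log n := by
    rw [Real.le_log_iff_exp_le (by linarith)]
    linarith [Real.exp_one_lt_d9]
  have hkey := (h n).half_sub_one_le (s := D / 2) (by omega) hμ hμL (by positivity) (by linarith)
  have heps : 1 / (μ * (D / 2) ^ 2 / (2 * n)) = a * n := by
    rw [ha_def]
    field_simp
  simp only [heps] at hkey
  set m := max (Real.log (a * n) ^ p) 1 with hm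
  have hm0 : 0 < m := lt_of_lt_of_le one_pos (le_max_right _ _)
  -- Otherwise `C n * m < 0`, against `n / 2 - 1 > 0`.
  have hC : 0 ≤ C n := by
    by_contra! hneg
    nlinarith [mul_pos_of_neg_of_neg hneg (neg_neg_of_pos hm0)]
  have hmle : m ≤ 2 ^ p * Real.log n ^ p := by
    rw [← mul_pow]
    refine max_le ?_ (one_le_pow₀ (by linarith))
    calc Real.log (a * n) ^ p ≤ |Real.log (a * n)| ^ p := by
          rw [← abs_pow]
          exact le_abs_self _
      _ ≤ (2 * Real.log n) ^ p := by
          gcongr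
          exact abs_log_mul_le_two_mul_log ha (by linarith) han han'
  have hsqrt : Real.sqrt n ≤ n := Real.sqrt_le_self_iff.2 (Or.inr (by linarith))
  have hfin : Real.sqrt n ≤ C n * (4 * 2 ^ p * Real.log n ^ p) := by
    have := mul_le_mul_of_nonneg_left hmle hC
    linarith
  calc 1 / (4 * 2 ^ p) * (Real.sqrt n / Real.log n ^ p)
      = Real.sqrt n / (4 * 2 ^ p * Real.log n ^ p) := by rw [div_mul_div_comm, one_mul]
    _ ≤ C n := (div_le_iff₀ (by positivity)).2 hfin
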